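/- **Theorem 1.** Let $\mathbb{R}^{4}$ have coordinates $(q_1,q_2,p_1,p_2)$ and the symplectic form $\omega_{\rm std}=dp_1\wedge dq_1+dp_2\wedge dq_2$. For $r>0$ let $B^4(r)=\{(q,p)\in\mathbb{R}^4 : |q|^2+|p|^2<r^2\}$ be the open ball of radius $r$ and $B^4_{\mathbb{R}}(r)=\{(q,p)\in B^4(r) : p=0\}$ its real part. Let $\omega_{\rm FS}$ be the Fubini–Study form on $\mathbb{CP}^2$, normalised so that a complex projective line has area $\pi$; in affine coordinates it is $\frac{i}{2}\partial\bar\partial\log(1+|w|^2)$. Let $\mathbb{T}^2_{\rm Cliff}=\{[z_0:z_1:z_2]\in\mathbb{CP}^2 : |z_0|=|z_1|=|z_2|\}$ be the Clifford torus. For every $r$ with $0<r<\sqrt{2/3}$ there exists a relative symplectic packing of $B^4(r)$ into $(\mathbb{CP}^2,\mathbb{T}^2_{\rm Cliff})$, that is, a smooth embedding $i: B^4(r)\hookrightarrow\mathbb{CP}^2$ such that $i^*\omega_{\rm FS}=\omega_{\rm std}$ and $i^{-1}(\mathbb{T}^2_{\rm Cliff})=B^4_{\mathbb{R}}(r)$.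 -/

import Mathlib

open Set Topology
open scoped Manifold ContDiff

/-! ### Complex projective space as a smooth real manifold -/

/-- Complex projective space `ℂPⁿ`: the complex lines through the origin in `ℂⁿ⁺¹`. -/
abbrev CP (n : ℕ) : Type := Projectivization ℂ (Fin (n + 1) → ℂ)

namespace CP

/-- The quotient topology from `ℂⁿ⁺¹ ∖ {0}`. -/
instance instTopologicalSpace (n : ℕ) : TopologicalSpace (CP n) :=
  inferInstanceAs
    (TopologicalSpace (Quotient (projectivizationSetoid ℂ (Fin (n + 1) → ℂ))))

lemma continuous_mk' (n : ℕ) :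
    Continuous (Projectivization.mk' ℂ : {v : Fin (n + 1) → ℂ // v ≠ 0} → CP n) :=
  continuous_quot_mk

lemma isQuotientMap_mk' (n : ℕ) :
    IsQuotientMap (Projectivization.mk' ℂ : {v : Fin (n + 1) → ℂ // v ≠ 0} → CP n) :=
  isQuotientMap_quot_mk

lemma insertNth_one_ne_zero {n : ℕ} (j : Fin (n + 1)) (w : Fin n → ℂ) :
    (j.insertNth 1 w : Fin (n + 1) → ℂ) ≠ 0 := fun h => by
  simpa using congrFun h j

/-- The set of points `[z₀ : … : zₙ]` with `z_j ≠ 0`. -/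
def affineSource {n : ℕ} (j : Fin (n + 1)) : Set (CP n) := {y | y.rep j ≠ 0}

/-- The affine coordinates `[z₀ : … : zₙ] ↦ (z_k / z_j)_{k ≠ j}`. -/
noncomputable def affineCoord {n : ℕ} (j : Fin (n + 1)) (y : CP n) : Fin n → ℂ :=
  fun l => y.rep (j.succAbove l) / y.rep j

/-- The inverse of the affine coordinates: `w ↦ [w₀ : … : 1 : … : wₙ₋₁]`, with `1` in position
`j`. -/
noncomputable def affineInv {n : ℕ} (j : Fin (n + 1)) (w : Fin n → ℂ) : CP n :=
  Projectivization.mk ℂ (j.insertNth 1 w) (insertNth_one_ne_zero j w)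

lemma mk_mem_affineSource {n : ℕ} (j : Fin (n + 1)) (v : Fin (n + 1) → ℂ) (hv : v ≠ 0) :
    (Projectivization.mk ℂ v hv : CP n) ∈ affineSource j ↔ v j ≠ 0 := by
  obtain ⟨a, ha⟩ := Projectivization.exists_smul_eq_mk_rep ℂ v hv
  simp [affineSource, ← ha, Units.smul_def]

lemma affineCoord_mk {n : ℕ} (j : Fin (n + 1)) (v : Fin (n + 1) → ℂ) (hv : v ≠ 0) :
    affineCoord j (Projectivization.mk ℂ v hv : CP n) = fun l => v (j.succAbove l) / v j := by
  obtain ⟨a, ha⟩ := Projectivization.exists_smul_eq_mk_rep ℂ v hv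
  funext l
  simp [affineCoord, ← ha, Units.smul_def, mul_div_mul_left]

lemma isOpen_affineSource {n : ℕ} (j : Fin (n + 1)) : IsOpen (affineSource j : Set (CP n)) := by
  rw [← (isQuotientMap_mk' n).isOpen_preimage]
  have h : (Projectivization.mk' ℂ : {v : Fin (n + 1) → ℂ // v ≠ 0} → CP n) ⁻¹' affineSource j
      = {v | v.1 j ≠ 0} := by
    ext v
    exact mk_mem_affineSource j v.1 v.2
  rw [h]
  exact isOpen_ne_fun ((continuous_apply j).comp continuous_subtype_val) continuous_const

lemma affineInv_mem {n : ℕ} (j : Fin (n + 1)) (w : Fin n → ℂ) :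
    affineInv j w ∈ affineSource j := by
  rw [affineInv, mk_mem_affineSource]
  simp

lemma affineCoord_affineInv {n : ℕ} (j : Fin (n + 1)) (w : Fin n → ℂ) :
    affineCoord j (affineInv j w) = w := by
  rw [affineInv, affineCoord_mk]
  simp

lemma affineInv_affineCoord {n : ℕ} (j : Fin (n + 1)) (y : CP n) (hy : y ∈ affineSource j) :
    affineInv j (affineCoord j y) = y := by
  induction y using Projectivization.ind with
  | h v hv =>
    rw [mk_mem_affineSource] at hy
    rw [affineCoord_mk, affineInv, Projectivization.mk_eq_mk_iff']
    refine ⟨(v j)⁻¹, ?_⟩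
    funext k
    refine Fin.succAboveCases j ?_ (fun l => ?_) k
    · simp [hy]
    · simp [div_eq_inv_mul]

lemma continuous_affineInv {n : ℕ} (j : Fin (n + 1)) :
    Continuous (affineInv j : (Fin n → ℂ) → CP n) := by
  have h : Continuous fun w : Fin n → ℂ =>
      (⟨j.insertNth 1 w, insertNth_one_ne_zero j w⟩ : {v : Fin (n + 1) → ℂ // v ≠ 0}) :=
    Continuous.subtype_mk
      (Continuous.finInsertNth (A := fun _ => ℂ) j continuous_const continuous_id) _
  exact (continuous_mk' n).comp h

lemma continuousOn_affineCoord {n : ℕ} (j : Fin (n + 1)) :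
    ContinuousOn (affineCoord j : CP n → Fin n → ℂ) (affineSource j) := by
  rw [(isQuotientMap_mk' n).continuousOn_isOpen_iff (isOpen_affineSource j)]
  have h : ContinuousOn (fun v : {v : Fin (n + 1) → ℂ // v ≠ 0} =>
      fun l : Fin n => v.1 (j.succAbove l) / v.1 j) {v | v.1 j ≠ 0} := by
    refine continuousOn_pi.2 fun l => ContinuousOn.div ?_ ?_ fun v hv => hv
    · exact ((continuous_apply _).comp continuous_subtype_val).continuousOn
    · exact ((continuous_apply _).comp continuous_subtype_val).continuousOn
  refine (h.mono fun v hv => (mk_mem_affineSource j v.1 v.2).1 hv).congr fun v _ => ?_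
  exact affineCoord_mk j v.1 v.2

/-- The `j`-th standard affine chart of `ℂPⁿ`. -/
noncomputable def affineChart {n : ℕ} (j : Fin (n + 1)) :
    OpenPartialHomeomorph (CP n) (Fin n → ℂ) where
  toFun := affineCoord j
  invFun := affineInv j
  source := affineSource j
  target := univ
  map_source' := fun _ _ => mem_univ _
  map_target' := fun w _ => affineInv_mem j w
  left_inv' := fun y hy => affineInv_affineCoord j y hy
  right_inv' := fun w _ => affineCoord_affineInv j w
  open_source := isOpen_affineSource j
  open_target := isOpen_univ
  continuousOn_toFun := continuousOn_affineCoord j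
  continuousOn_invFun := (continuous_affineInv j).continuousOn

lemma exists_rep_ne_zero {n : ℕ} (y : CP n) : ∃ j, y.rep j ≠ 0 :=
  Function.ne_iff.1 y.rep_nonzero

open Classical in
/-- The smallest index of a nonzero homogeneous coordinate; it selects the preferred chart. -/
noncomputable def chartIndex {n : ℕ} (y : CP n) : Fin (n + 1) :=
  Fin.find (fun j => y.rep j ≠ 0) (exists_rep_ne_zero y)

/-- The atlas of `ℂPⁿ` given by the standard affine charts. -/
noncomputable instance instChartedSpace (n : ℕ) : ChartedSpace (Fin n → ℂ) (CP n) where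
  atlas := range affineChart
  chartAt := fun y => affineChart (chartIndex y)
  mem_chart_source := fun y => by
    classical
    exact Fin.find_spec (exists_rep_ne_zero y)
  chart_mem_atlas := fun y => mem_range_self _

/-- `ℂPⁿ` is a smooth real manifold (of dimension `2n`). -/
instance instIsManifold (n : ℕ) : IsManifold 𝓘(ℝ, Fin n → ℂ) ∞ (CP n) := by
  apply isManifold_of_contDiffOn
  rintro _ _ ⟨j, rfl⟩ ⟨k, rfl⟩
  have hins : ContDiff ℝ ∞ fun w : Fin n → ℂ => (j.insertNth 1 w : Fin (n + 1) → ℂ) := by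
    refine contDiff_pi.2 fun i => ?_
    refine Fin.succAboveCases j ?_ (fun l => ?_) i
    · simpa using contDiff_const
    · simpa using contDiff_apply ℝ ℂ l
  have hcomp : ∀ i, ContDiff ℝ ∞ fun w : Fin n → ℂ => (j.insertNth 1 w : Fin (n + 1) → ℂ) i :=
    fun i => contDiff_pi.1 hins i
  have h : ContDiffOn ℝ ∞ (fun w : Fin n → ℂ => fun l : Fin n =>
      (j.insertNth 1 w : Fin (n + 1) → ℂ) (k.succAbove l) /
        (j.insertNth 1 w : Fin (n + 1) → ℂ) k)
      {w | (j.insertNth 1 w : Fin (n + 1) → ℂ) k ≠ 0} :=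
    contDiffOn_pi.2 fun l => by
      simp only [div_eq_mul_inv]
      exact (hcomp _).contDiffOn.mul ((hcomp k).contDiffOn.inv fun w hw => hw)
  refine (h.mono ?_).congr ?_
  · rintro w ⟨hw, -⟩
    have hw' : affineInv j w ∈ affineSource k := hw.2
    exact (mk_mem_affineSource k _ _).1 hw'
  · rintro w -
    exact affineCoord_mk k _ _

/-! ### The Fubini–Study form and the Clifford torus -/

/-- The standard Hermitian product `∑ₖ conj(aₖ) bₖ` on `ℂⁿ`. -/
noncomputable def herm {n : ℕ} (a b : Fin n → ℂ) : ℂ := star a ⬝ᵥ b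

/-- The Fubini–Study form in affine coordinates, at the point `w ∈ ℂⁿ`: the form
`(i/2) ∂∂̄ log (1 + |w|²)`, that is, the imaginary part of the Hermitian form
`(u, v) ↦ ((1 + |w|²) ⟨u, v⟩ - ⟨u, w⟩ ⟨w, v⟩) / (1 + |w|²)²`. For `n = 1` it is
`dx ∧ dy / (1 + x² + y²)²`, so that a complex projective line has area `π`. -/
noncomputable def fubiniStudyAffine {n : ℕ} (w : Fin n → ℂ) : LinearMap.BilinForm ℝ (Fin n → ℂ) :=
  LinearMap.mk₂ ℝ
    (fun u v => (((1 + herm w w) * herm u v - herm u w * herm w v) / (1 + herm w w) ^ 2).im)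
    (fun u u' v => by
      rw [← Complex.add_im]; congr 1; simp only [herm, star_add, add_dotProduct]; ring)
    (fun c u v => by
      rw [← Complex.smul_im]; congr 1
      simp only [herm, star_smul, star_trivial, smul_dotProduct, Complex.real_smul]; ring)
    (fun u v v' => by
      rw [← Complex.add_im]; congr 1; simp only [herm, dotProduct_add]; ring)
    (fun c u v => by
      rw [← Complex.smul_im]; congr 1
      simp only [herm, dotProduct_smul, Complex.real_smul]; ring)

/-- The Fubini–Study form `ω_FS` on `ℂPⁿ`, normalised so that a line has area `π`. The tangent
space at `y` is identified with `ℂⁿ` through the preferred chart at `y`, which is an affine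
chart; the coordinate expression of the form is the same in all affine charts. -/
noncomputable def fubiniStudy {n : ℕ} (y : CP n) :
    LinearMap.BilinForm ℝ (TangentSpace 𝓘(ℝ, Fin n → ℂ) y) :=
  fubiniStudyAffine (chartAt (Fin n → ℂ) y y)

/-- The Clifford torus `{[z₀ : … : zₙ] : |z₀| = … = |zₙ|}`. -/
def cliffordTorus (n : ℕ) : Set (CP n) :=
  {y | ∃ (v : Fin (n + 1) → ℂ) (hv : v ≠ 0),
    (∀ i j, ‖v i‖ = ‖v j‖) ∧ Projectivization.mk ℂ v hv = y}

end CP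

/-! ### The standard ball and relative symplectic packings -/

/-- The Euclidean space `ℝ²ⁿ`, with coordinates `q_k = x (Sum.inl k)` and `p_k = x (Sum.inr k)`. -/
abbrev PhaseSpace (n : ℕ) : Type := EuclideanSpace ℝ (Fin n ⊕ Fin n)

/-- The standard symplectic form `∑ₖ dp_k ∧ dq_k` on `ℝ²ⁿ`. -/
def omegaStd {n : ℕ} (u v : PhaseSpace n) : ℝ :=
  ∑ k, (u (Sum.inr k) * v (Sum.inl k) - u (Sum.inl k) * v (Sum.inr k))

/-- The open ball `B²ⁿ(r)`. -/
def stdBall (n : ℕ) (r : ℝ) : Set (PhaseSpace n) := Metric.ball 0 r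

/-- The real part `B²ⁿ_ℝ(r) = {(q, p) ∈ B²ⁿ(r) : p = 0}`. -/
def realBall (n : ℕ) (r : ℝ) : Set (PhaseSpace n) :=
  {x ∈ stdBall n r | ∀ k, x (Sum.inr k) = 0}

/-- `i` restricts to a symplectic embedding of `B²ⁿ(r)` into the manifold `M` with the 2-form `Ω`:
a smooth map which is an immersion, a homeomorphism onto its image, and satisfies
`i^* Ω = ω_std`. The values of `i` outside of the ball are irrelevant. -/
structure IsSymplecticBallEmbedding {n : ℕ} {F : Type*} [NormedAddCommGroup F] [NormedSpace ℝ F]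
    {M : Type*} [TopologicalSpace M] [ChartedSpace F M]
    (Ω : ∀ y : M, LinearMap.BilinForm ℝ (TangentSpace 𝓘(ℝ, F) y))
    (r : ℝ) (i : PhaseSpace n → M) : Prop where
  smooth : ContMDiffOn 𝓘(ℝ, PhaseSpace n) 𝓘(ℝ, F) ∞ i (stdBall n r)
  immersion : ∀ x ∈ stdBall n r,
    Function.Injective (mfderiv 𝓘(ℝ, PhaseSpace n) 𝓘(ℝ, F) i x)
  embedding : IsEmbedding fun x : stdBall n r => i x
  symplectic : ∀ x ∈ stdBall n r, ∀ u v : PhaseSpace n,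
    Ω (i x) (mfderiv 𝓘(ℝ, PhaseSpace n) 𝓘(ℝ, F) i x u)
      (mfderiv 𝓘(ℝ, PhaseSpace n) 𝓘(ℝ, F) i x v) = omegaStd u v

/-- `i` is a relative packing of `B²ⁿ(r)` into `(M, L)`: a symplectic embedding of the ball into
`(M, Ω)` for which the preimage of `L` is exactly the real part of the ball. -/
structure IsRelativePacking {n : ℕ} {F : Type*} [NormedAddCommGroup F] [NormedSpace ℝ F]
    {M : Type*} [TopologicalSpace M] [ChartedSpace F M]
    (Ω : ∀ y : M, LinearMap.BilinForm ℝ (TangentSpace 𝓘(ℝ, F) y)) (L : Set M)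
    (r : ℝ) (i : PhaseSpace n → M) : Prop extends IsSymplecticBallEmbedding Ω r i where
  preimage_eq : stdBall n r ∩ i ⁻¹' L = realBall n r

/-! In moment–angle coordinates the Fubini–Study form is `½ ∑ dμₖ ∧ dtₖ`
(`CP.fubiniStudyAffine_toricCoord`), and the Clifford torus is the fibre over the barycentre of the
moment simplex. So it suffices to find a planar map `(X, T)` into `ℝ × (-π, π)` with `dX ∧ dT = 2 dp
∧ dq` and `{X = 0} = {p = 0}`, apply it in each coordinate plane, and put `μₖ = 1/3 + Xₖ`, `tₖ =
Tₖ`. The image stays in the open simplex when `|X₀| + |X₁| < 1/3`. If `2|X|` is almost bounded by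
`q² + p²`, this holds on balls with `r² < 2/3`.

The singular model is `X = ±(q² + p²)/2` on the half-planes `±p > 0`, with `T` twice a polar angle:
each half-disc fills a full cylinder. Its level curves `p = ±√(2x - q²)`, continued along the
`q`-axis, have corners. Replacing the roots by real parts of complex roots shifted by `2e²i` gives
smooth graphs `p = heightFun e (q, x)`, strictly increasing in `x`. The area condition becomes
`∂T/∂q = 2 ∂p/∂x`, which integrates to arctangents (`hasDerivAt_arctan_sqrt`). `arctan_sqrt_add_pos`
keeps `T` in an interval of length `2π`, and `abs_le_heightFun` controls `X`. `exists_planar_map`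
collects these properties. -/

/-! ### The real and imaginary parts of `√(s + 2e²i)` -/

/-- The real part of the principal square root of `s + 2e²i`. -/
noncomputable def sqrtRe (e s : ℝ) : ℝ := √((√(s ^ 2 + 4 * e ^ 4) + s) / 2)

/-- The imaginary part of the principal square root of `s + 2e²i`. -/
noncomputable def sqrtIm (e s : ℝ) : ℝ := e ^ 2 / sqrtRe e s

section ComplexSqrt

variable {e : ℝ}

lemma sqrtRe_radicand_pos (he : 0 < e) (s : ℝ) : 0 < (√(s ^ 2 + 4 * e ^ 4) + s) / 2 := by
  have h : |s| < √(s ^ 2 + 4 * e ^ 4) := by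
    rw [← Real.sqrt_sq_eq_abs]
    exact Real.sqrt_lt_sqrt (sq_nonneg s) (by linarith [pow_pos he 4])
  linarith [neg_abs_le s]

lemma sqrtRe_pos (he : 0 < e) (s : ℝ) : 0 < sqrtRe e s :=
  Real.sqrt_pos.2 (sqrtRe_radicand_pos he s)

lemma sqrtIm_pos (he : 0 < e) (s : ℝ) : 0 < sqrtIm e s :=
  div_pos (pow_pos he 2) (sqrtRe_pos he s)

lemma sqrtRe_mul_sqrtIm (he : 0 < e) (s : ℝ) : sqrtRe e s * sqrtIm e s = e ^ 2 :=
  mul_div_cancel₀ _ (sqrtRe_pos he s).ne'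

/-- Eliminating the imaginary part from the equation for the complex root leaves this quadratic in
the squared real part; differentiating it later gives the derivative of `sqrtRe`. -/
lemma sqrtRe_sq_mul (he : 0 < e) (s : ℝ) :
    sqrtRe e s ^ 2 * (sqrtRe e s ^ 2 - s) = e ^ 4 := by
  have h : 0 ≤ s ^ 2 + 4 * e ^ 4 := by positivity
  rw [sqrtRe, Real.sq_sqrt (sqrtRe_radicand_pos he s).le]
  linear_combination (Real.sq_sqrt h) / 4

lemma sqrtRe_sq_sub_sqrtIm_sq (he : 0 < e) (s : ℝ) :
    sqrtRe e s ^ 2 - sqrtIm e s ^ 2 = s := by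
  have h := sqrtRe_sq_mul he s
  have hm := sqrtRe_mul_sqrtIm he s
  have hp := pow_pos (sqrtRe_pos he s) 2
  refine mul_left_cancel₀ hp.ne' ?_
  linear_combination h - (sqrtRe e s * sqrtIm e s + e ^ 2) * hm

lemma contDiff_sqrtRe (he : 0 < e) : ContDiff ℝ ∞ (sqrtRe e) := by
  refine ContDiff.sqrt ?_ fun s => (sqrtRe_radicand_pos he s).ne'
  refine ContDiff.div_const (ContDiff.add (ContDiff.sqrt (by fun_prop) fun s => ?_) contDiff_id) 2
  positivity

lemma contDiff_sqrtIm (he : 0 < e) : ContDiff ℝ ∞ (sqrtIm e) :=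
  contDiff_const.div (contDiff_sqrtRe he) fun s => (sqrtRe_pos he s).ne'

/-- Twice the derivative of `sqrtRe`: the real part of `1 / √(s + 2e²i)`. -/
noncomputable def invSqrtRe (e s : ℝ) : ℝ := sqrtRe e s / (sqrtRe e s ^ 2 + sqrtIm e s ^ 2)

lemma invSqrtRe_pos (he : 0 < e) (s : ℝ) : 0 < invSqrtRe e s := by
  have := sqrtRe_pos he s
  unfold invSqrtRe
  positivity

lemma hasDerivAt_sqrtRe (he : 0 < e) (s : ℝ) :
    HasDerivAt (sqrtRe e) (invSqrtRe e s / 2) s := by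
  have hd : HasDerivAt (sqrtRe e) (deriv (sqrtRe e) s) s :=
    ((contDiff_sqrtRe he).differentiable (by simp)).differentiableAt.hasDerivAt
  have hg := sqrtRe_pos he s
  have h1 : HasDerivAt (fun t => sqrtRe e t ^ 2 * (sqrtRe e t ^ 2 - t)) 0 s := by
    simp_rw [sqrtRe_sq_mul he]
    exact hasDerivAt_const _ _
  have h2 := (hd.pow 2).mul ((hd.pow 2).sub (hasDerivAt_id s))
  have h3 := h1.unique h2
  have h4 := sqrtRe_sq_sub_sqrtIm_sq he s
  have h5 : deriv (sqrtRe e) s = invSqrtRe e s / 2 := by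
    unfold invSqrtRe
    have : 0 < sqrtRe e s ^ 2 + sqrtIm e s ^ 2 := by positivity
    field_simp
    refine mul_left_cancel₀ hg.ne' ?_
    simp only [Pi.pow_apply, Pi.sub_apply, id] at h3
    push_cast at h3
    linear_combination -h3 - (2 * deriv (sqrtRe e) s * sqrtRe e s) * h4
  exact h5 ▸ hd

lemma hasDerivAt_sqrtIm (he : 0 < e) (s : ℝ) :
    HasDerivAt (sqrtIm e) (-(sqrtIm e s * invSqrtRe e s) / (2 * sqrtRe e s)) s := by
  have hg := sqrtRe_pos he s
  have h := (hasDerivAt_const s (e ^ 2)).div (hasDerivAt_sqrtRe he s) hg.ne'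
  refine h.congr_deriv ?_
  rw [← sqrtRe_mul_sqrtIm he s]
  field_simp
  ring

lemma le_sqrtRe_sq (he : 0 < e) (s : ℝ) : s ≤ sqrtRe e s ^ 2 := by
  linarith [sqrtRe_sq_sub_sqrtIm_sq he s, sq_nonneg (sqrtIm e s)]

lemma sqrtRe_le (he : 0 < e) {s : ℝ} (hs : s ≤ 0) : sqrtRe e s ≤ e := by
  have h := sqrtRe_sq_mul he s
  have hg := sqrtRe_pos he s
  -- With `g = sqrtRe e s`, the quadratic relation reads `g⁴ = e⁴ + s g²`, and `s ≤ 0`.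
  refine le_of_pow_le_pow_left₀ (n := 4) (by norm_num) he.le ?_
  nlinarith [mul_nonneg (sq_nonneg (sqrtRe e s)) (neg_nonneg.2 hs)]

/-- The antiderivative in `q` of the real part of `1 / √(s - q² + 2e²i)`. -/
lemma hasDerivAt_arctan_sqrt (he : 0 < e) (c q : ℝ) :
    HasDerivAt (fun t => Real.arctan ((sqrtIm e (c - t ^ 2) + t) / sqrtRe e (c - t ^ 2)))
      (invSqrtRe e (c - q ^ 2)) q := by
  have hs : HasDerivAt (fun t : ℝ => c - t ^ 2) (-(2 * q)) q := by
    simpa using ((hasDerivAt_id q).pow 2).const_sub c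
  have hg := sqrtRe_pos he (c - q ^ 2)
  have hG := (hasDerivAt_sqrtRe he (c - q ^ 2)).comp q hs
  have hH := (hasDerivAt_sqrtIm he (c - q ^ 2)).comp q hs
  have h := ((hH.add (hasDerivAt_id q)).div hG hg.ne').arctan
  refine h.congr_deriv ?_
  simp only [invSqrtRe, Function.comp, Pi.div_apply, Pi.add_apply, id]
  have h1 : 0 < sqrtRe e (c - q ^ 2) ^ 2 + (sqrtIm e (c - q ^ 2) + q) ^ 2 := by positivity
  have h2 : 0 < sqrtRe e (c - q ^ 2) ^ 2 + sqrtIm e (c - q ^ 2) ^ 2 := by positivity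
  field_simp
  ring

/-- The arguments of `√(c₊ - q²) + iq` and `√(c₋ - q²) + iq` add up to a positive angle
when `c₊` and `c₋` are `±x + 2e²i`. -/
lemma arctan_sqrt_add_pos (he : 0 < e) (x q : ℝ) :
    0 < Real.arctan ((sqrtIm e (x - q ^ 2) + q) / sqrtRe e (x - q ^ 2)) +
      Real.arctan ((sqrtIm e (-x - q ^ 2) + q) / sqrtRe e (-x - q ^ 2)) := by
  have ha := sqrtRe_pos he (x - q ^ 2)
  have hb := sqrtRe_pos he (-x - q ^ 2)
  have hh := sqrtIm_pos he (x - q ^ 2)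
  have hk := sqrtIm_pos he (-x - q ^ 2)
  have ha1 := sqrtRe_sq_sub_sqrtIm_sq he (x - q ^ 2)
  have hb1 := sqrtRe_sq_sub_sqrtIm_sq he (-x - q ^ 2)
  have ha2 := sqrtRe_mul_sqrtIm he (x - q ^ 2)
  have hb2 := sqrtRe_mul_sqrtIm he (-x - q ^ 2)
  set a := sqrtRe e (x - q ^ 2)
  set b := sqrtRe e (-x - q ^ 2)
  set h := sqrtIm e (x - q ^ 2)
  set k := sqrtIm e (-x - q ^ 2)
  -- Since `arctan` is odd and increasing, only the sign of the sum of the slopes matters.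
  suffices H : 0 < (h + q) / a + (k + q) / b by
    have := Real.arctan_strictMono (show -((k + q) / b) < (h + q) / a by linarith)
    rw [Real.arctan_neg] at this
    linarith
  have H : -q * (a + b) < h * b + k * a := by
    refine lt_of_pow_lt_pow_left₀ 2 (by positivity) ?_
    -- Lagrange's identity: the other square `(ha - kb)²` vanishes because `ah = bk = e²`, and `h² +
    -- k² = a² + b² + 2q²`. The comparison then uses `(a + b)² ≤ 2(a² + b²)`.
    have hsq : (h * b + k * a) ^ 2 = (a ^ 2 + b ^ 2) * (a ^ 2 + b ^ 2 + 2 * q ^ 2) := by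
      linear_combination -(a * h - b * k) * (ha2 - hb2) - (a ^ 2 + b ^ 2) * (ha1 + hb1)
    have hS : 0 < (a ^ 2 + b ^ 2) ^ 2 := by positivity
    rw [hsq]
    nlinarith [mul_nonneg (sq_nonneg q) (sq_nonneg (a - b))]
  rw [div_add_div _ _ ha.ne' hb.ne']
  refine div_pos ?_ (by positivity)
  linarith

end ComplexSqrt

/-! ### The planar map -/

/-- For fixed `x`, the graph of `q ↦ heightFun e (q, x)` is the level curve `{X = x}` of the action
variable `X`. -/
noncomputable def heightFun (e : ℝ) (z : ℝ × ℝ) : ℝ :=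
  sqrtRe e (2 * z.2 - z.1 ^ 2) - sqrtRe e (-(2 * z.2) - z.1 ^ 2)

/-- The angle variable, as a function of `q` and of the action `x`. -/
noncomputable def angleFun (e : ℝ) (z : ℝ × ℝ) : ℝ :=
  2 * (Real.arctan ((sqrtIm e (2 * z.2 - z.1 ^ 2) + z.1) / sqrtRe e (2 * z.2 - z.1 ^ 2)) +
    Real.arctan ((sqrtIm e (-(2 * z.2) - z.1 ^ 2) + z.1) / sqrtRe e (-(2 * z.2) - z.1 ^ 2)))
    - Real.pi

/-- The derivative of `heightFun` in the action variable. -/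
noncomputable def heightDeriv (e : ℝ) (z : ℝ × ℝ) : ℝ :=
  invSqrtRe e (2 * z.2 - z.1 ^ 2) + invSqrtRe e (-(2 * z.2) - z.1 ^ 2)

lemma fderiv_prod_apply {f : ℝ × ℝ → ℝ} (z u : ℝ × ℝ) :
    fderiv ℝ f z u = u.1 * fderiv ℝ f z (1, 0) + u.2 * fderiv ℝ f z (0, 1) := by
  have hu : u = u.1 • ((1 : ℝ), (0 : ℝ)) + u.2 • ((0 : ℝ), (1 : ℝ)) := by
    ext <;> simp
  conv_lhs => rw [hu]
  simp only [map_add, map_smul, smul_eq_mul]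

section Planar

variable {e : ℝ}

lemma contDiff_heightFun (he : 0 < e) : ContDiff ℝ ∞ (heightFun e) :=
  ((contDiff_sqrtRe he).comp (by fun_prop)).sub ((contDiff_sqrtRe he).comp (by fun_prop))

lemma contDiff_angleFun (he : 0 < e) : ContDiff ℝ ∞ (angleFun e) := by
  have h : ∀ {s : ℝ × ℝ → ℝ}, ContDiff ℝ ∞ s → ContDiff ℝ ∞ fun z : ℝ × ℝ =>
      Real.arctan ((sqrtIm e (s z) + z.1) / sqrtRe e (s z)) := fun hs =>
    ((((contDiff_sqrtIm he).comp hs).add contDiff_fst).div ((contDiff_sqrtRe he).comp hs)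
      fun z => (sqrtRe_pos he _).ne').arctan
  exact (contDiff_const.mul ((h (by fun_prop)).add (h (by fun_prop)))).sub contDiff_const

lemma heightDeriv_pos (he : 0 < e) (z : ℝ × ℝ) : 0 < heightDeriv e z :=
  add_pos (invSqrtRe_pos he _) (invSqrtRe_pos he _)

lemma hasDerivAt_heightFun (he : 0 < e) (q x : ℝ) :
    HasDerivAt (fun t => heightFun e (q, t)) (heightDeriv e (q, x)) x := by
  have h1 : HasDerivAt (fun t : ℝ => 2 * t - q ^ 2) 2 x := by
    simpa using ((hasDerivAt_id x).const_mul 2).sub_const (q ^ 2)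
  have h2 : HasDerivAt (fun t : ℝ => -(2 * t) - q ^ 2) (-2) x := by
    simpa using ((hasDerivAt_id x).const_mul 2).neg.sub_const (q ^ 2)
  refine (((hasDerivAt_sqrtRe he _).comp x h1).sub
    ((hasDerivAt_sqrtRe he _).comp x h2)).congr_deriv ?_
  simp only [heightDeriv]
  ring

lemma hasDerivAt_angleFun (he : 0 < e) (q x : ℝ) :
    HasDerivAt (fun t => angleFun e (t, x)) (2 * heightDeriv e (q, x)) q :=
  (((hasDerivAt_arctan_sqrt he (2 * x) q).add
    (hasDerivAt_arctan_sqrt he (-(2 * x)) q)).const_mul 2).sub_const Real.pi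

lemma fderiv_heightFun (he : 0 < e) (z : ℝ × ℝ) :
    fderiv ℝ (heightFun e) z (0, 1) = heightDeriv e z := by
  have h := ((contDiff_heightFun he).differentiable (by simp) z).hasFDerivAt
  have h1 : HasDerivAt (fun t : ℝ => (z.1, t)) ((0 : ℝ), (1 : ℝ)) z.2 :=
    (hasDerivAt_const _ _).prodMk (hasDerivAt_id _)
  exact (HasFDerivAt.comp_hasDerivAt (l := heightFun e) z.2 h h1).unique (hasDerivAt_heightFun he z.1 z.2)

lemma fderiv_angleFun (he : 0 < e) (z : ℝ × ℝ) :
    fderiv ℝ (angleFun e) z (1, 0) = 2 * heightDeriv e z := by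
  have h := ((contDiff_angleFun he).differentiable (by simp) z).hasFDerivAt
  have h1 : HasDerivAt (fun t : ℝ => (t, z.2)) ((1 : ℝ), (0 : ℝ)) z.1 :=
    (hasDerivAt_id _).prodMk (hasDerivAt_const _ _)
  exact (HasFDerivAt.comp_hasDerivAt (l := angleFun e) z.1 h h1).unique (hasDerivAt_angleFun he z.1 z.2)

lemma strictMono_heightFun (he : 0 < e) (q : ℝ) : StrictMono fun x => heightFun e (q, x) :=
  strictMono_of_deriv_pos fun x => by
    rw [(hasDerivAt_heightFun he q x).deriv]
    exact heightDeriv_pos he _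

lemma strictMono_angleFun (he : 0 < e) (x : ℝ) : StrictMono fun q => angleFun e (q, x) :=
  strictMono_of_deriv_pos fun q => by
    rw [(hasDerivAt_angleFun he q x).deriv]
    exact mul_pos two_pos (heightDeriv_pos he _)

/-- The upper bound is `arctan < π/2` in both terms; the lower bound is the positivity of their sum.
Subtracting `π` centres the interval. -/
lemma abs_angleFun_lt (he : 0 < e) (z : ℝ × ℝ) : |angleFun e z| < Real.pi := by
  have h := arctan_sqrt_add_pos he (2 * z.2) z.1
  have h1 := Real.arctan_lt_pi_div_two
    ((sqrtIm e (2 * z.2 - z.1 ^ 2) + z.1) / sqrtRe e (2 * z.2 - z.1 ^ 2))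
  have h2 := Real.arctan_lt_pi_div_two
    ((sqrtIm e (-(2 * z.2) - z.1 ^ 2) + z.1) / sqrtRe e (-(2 * z.2) - z.1 ^ 2))
  rw [angleFun, abs_lt]
  constructor <;> linarith

lemma heightFun_zero (q : ℝ) : heightFun e (q, 0) = 0 := by simp [heightFun]

lemma heightFun_neg (q x : ℝ) : heightFun e (q, -x) = -heightFun e (q, x) := by
  simp [heightFun]

/-- For `x ≥ 0` the subtracted root has nonpositive real radicand, so it costs at most `e`, while
the first root has square at least `2x - q²`. -/
lemma le_heightFun (he : 0 < e) {q x : ℝ} (hx : 0 ≤ x) :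
    2 * x ≤ q ^ 2 + (heightFun e (q, x) + e) ^ 2 := by
  have h1 := le_sqrtRe_sq he (2 * x - q ^ 2)
  have h2 := sqrtRe_le he (s := -(2 * x) - q ^ 2) (by nlinarith [sq_nonneg q])
  have h3 : sqrtRe e (2 * x - q ^ 2) ≤ heightFun e (q, x) + e := by
    simp only [heightFun]; linarith
  nlinarith [pow_le_pow_left₀ (sqrtRe_pos he _).le h3 2]

lemma abs_le_heightFun (he : 0 < e) (q x : ℝ) :
    2 * |x| ≤ q ^ 2 + (|heightFun e (q, x)| + e) ^ 2 := by
  have key : ∀ y, 0 ≤ y → 2 * y ≤ q ^ 2 + (|heightFun e (q, y)| + e) ^ 2 := fun y hy => by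
    have h0 : 0 ≤ heightFun e (q, y) := by
      simpa [heightFun_zero] using (strictMono_heightFun he q).monotone hy
    rw [abs_of_nonneg h0]
    exact le_heightFun he hy
  rcases abs_cases x with ⟨h, -⟩ | ⟨h, -⟩
  · simpa [h] using key |x| (abs_nonneg x)
  · simpa [h, heightFun_neg] using key |x| (abs_nonneg x)

lemma surjective_heightFun (he : 0 < e) (q : ℝ) : Function.Surjective fun x => heightFun e (q, x) := by
  intro p
  have hle : ∃ x, |p| ≤ heightFun e (q, x) := by
    -- For this `x`, `le_heightFun` becomes `(|p| + e)² ≤ (heightFun e (q, x) + e)²`.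
    refine ⟨(q ^ 2 + (|p| + e) ^ 2) / 2, ?_⟩
    have hx : 0 ≤ (q ^ 2 + (|p| + e) ^ 2) / 2 := by positivity
    have h := le_heightFun he (q := q) hx
    have h0 : 0 ≤ heightFun e (q, (q ^ 2 + (|p| + e) ^ 2) / 2) := by
      simpa [heightFun_zero] using (strictMono_heightFun he q).monotone hx
    exact (add_le_add_iff_right e).1
      (le_of_pow_le_pow_left₀ (n := 2) (by norm_num) (by positivity) (by linarith))
  obtain ⟨x, hx⟩ := hle
  refine mem_range_of_exists_le_of_exists_ge ?_ ⟨-x, ?_⟩ ⟨x, (le_abs_self p).trans hx⟩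
  · exact (contDiff_heightFun he).continuous.comp (by fun_prop)
  · simp only [heightFun_neg]
    linarith [neg_abs_le p]

end Planar

/-! ### Inverting the height function to obtain the planar symplectic map -/

lemma exists_hasStrictFDerivAt_equiv {E F : Type*} [NormedAddCommGroup E] [NormedSpace ℝ E]
    [NormedAddCommGroup F] [NormedSpace ℝ F] [FiniteDimensional ℝ E] [FiniteDimensional ℝ F]
    (hdim : Module.finrank ℝ E = Module.finrank ℝ F) {f : E → F} {x : E}
    (hf : ContDiffAt ℝ ∞ f x) (hinj : Function.Injective (fderiv ℝ f x)) :
    ∃ f' : E ≃L[ℝ] F, HasStrictFDerivAt f (f' : E →L[ℝ] F) x := by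
  refine ⟨(LinearEquiv.ofInjectiveOfFinrankEq (fderiv ℝ f x : E →ₗ[ℝ] F) hinj
    hdim).toContinuousLinearEquiv, ?_⟩
  exact hf.hasStrictFDerivAt (by simp)

/-- A smooth embedding `(X, T)` of the plane into the cylinder `ℝ × (-π, π)` with
`dX ∧ dT = 2 dp ∧ dq`, which maps the line `p = 0` to the circle `X = 0` and for which `2 |X|` is
close to being bounded by `q² + p²`. -/
theorem exists_planar_map {e : ℝ} (he : 0 < e) : ∃ X T : ℝ × ℝ → ℝ,
    ContDiff ℝ ∞ X ∧ ContDiff ℝ ∞ T ∧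
    (∀ z u v, fderiv ℝ X z u * fderiv ℝ T z v - fderiv ℝ X z v * fderiv ℝ T z u
      = 2 * (u.2 * v.1 - u.1 * v.2)) ∧
    (∀ z, |T z| < Real.pi) ∧ (∀ z, X z = 0 ↔ z.2 = 0) ∧
    (∀ z, 2 * |X z| ≤ z.1 ^ 2 + (|z.2| + e) ^ 2) ∧
    ∀ z z', X z = X z' → T z = T z' → z = z' := by
  choose x hx using fun z : ℝ × ℝ => surjective_heightFun he z.1 z.2
  dsimp only at hx
  have hcd : ContDiff ℝ ∞ fun z : ℝ × ℝ => (z.1, heightFun e z) :=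
    contDiff_fst.prodMk (contDiff_heightFun he)
  have hfd : ∀ z u, fderiv ℝ (fun z : ℝ × ℝ => (z.1, heightFun e z)) z u
      = (u.1, fderiv ℝ (heightFun e) z u) := fun z u => by
    rw [(hasFDerivAt_fst.prodMk
      ((contDiff_heightFun he).differentiable (by simp) z).hasFDerivAt).fderiv]
    simp
  have hequiv : ∀ z, ∃ f' : (ℝ × ℝ) ≃L[ℝ] (ℝ × ℝ),
      HasStrictFDerivAt (fun z : ℝ × ℝ => (z.1, heightFun e z)) (f' : (ℝ × ℝ) →L[ℝ] (ℝ × ℝ)) z := by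
    refine fun z => exists_hasStrictFDerivAt_equiv rfl hcd.contDiffAt ?_
    refine (injective_iff_map_eq_zero _).2 fun u hu => ?_
    rw [hfd, Prod.mk_eq_zero, fderiv_prod_apply, fderiv_heightFun he] at hu
    obtain ⟨h1, h2⟩ := hu
    rw [h1, zero_mul, zero_add, mul_eq_zero, or_iff_left (heightDeriv_pos he z).ne'] at h2
    exact Prod.ext h1 h2
  choose f' hf' using hequiv
  let E : ℝ × ℝ ≃ ℝ × ℝ :=
    { toFun := fun z => (z.1, heightFun e z)
      invFun := fun z => (z.1, x z)
      left_inv := fun z => Prod.ext rfl ((strictMono_heightFun he z.1).injective (hx _))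
      right_inv := fun z => Prod.ext rfl (hx z) }
  have hinv : ContDiff ℝ ∞ fun z : ℝ × ℝ => (z.1, x z) :=
    (E.toHomeomorphOfContinuousOpen hcd.continuous
      (isOpenMap_of_hasStrictFDerivAt_equiv hf')).contDiff_symm
      (fun z => (hf' z).hasFDerivAt) hcd
  have hX : ContDiff ℝ ∞ x := hinv.snd
  refine ⟨x, fun z => angleFun e (z.1, x z), hX, (contDiff_angleFun he).comp hinv, ?_, ?_, ?_, ?_, ?_⟩
  · intro z u v
    have hxd := (hX.differentiable (by simp) z).hasFDerivAt
    have hid : HasFDerivAt (fun z : ℝ × ℝ => (z.1, x z)) _ z := hasFDerivAt_fst.prodMk hxd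
    have hP := ((contDiff_heightFun he).differentiable (by simp) (z.1, x z)).hasFDerivAt.comp z hid
    have hT := ((contDiff_angleFun he).differentiable (by simp) (z.1, x z)).hasFDerivAt.comp z hid
    -- Implicit differentiation of `heightFun e (q, x (q, p)) = p`.
    have hP' : HasFDerivAt (Prod.snd : ℝ × ℝ → ℝ) _ z := hP.congr_of_eventuallyEq
      (Filter.Eventually.of_forall fun z => (hx z).symm)
    have hP'' := hP'.unique hasFDerivAt_snd
    have hTd : ∀ w, fderiv ℝ (fun z => angleFun e (z.1, x z)) z w = w.1 * (2 * heightDeriv e (z.1, x z))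
        + fderiv ℝ x z w * fderiv ℝ (angleFun e) (z.1, x z) (0, 1) := fun w => by
      rw [HasFDerivAt.fderiv (f := fun z : ℝ × ℝ => angleFun e (z.1, x z)) hT]
      rw [ContinuousLinearMap.comp_apply, fderiv_prod_apply, fderiv_angleFun he]
      simp
    have hPd : ∀ w : ℝ × ℝ, w.1 * fderiv ℝ (heightFun e) (z.1, x z) (1, 0)
        + fderiv ℝ x z w * heightDeriv e (z.1, x z) = w.2 := fun w => by
      have := DFunLike.congr_fun hP'' w
      rw [ContinuousLinearMap.comp_apply, fderiv_prod_apply, fderiv_heightFun he] at this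
      simpa using this
    rw [hTd, hTd]
    -- The unknown derivative of `angleFun` in `x` cancels by antisymmetry, as does that of
    -- `heightFun` in `q`.
    linear_combination 2 * v.1 * hPd u - 2 * u.1 * hPd v
  · exact fun z => abs_angleFun_lt he _
  · intro z
    rw [← hx z]
    conv_rhs => rw [← heightFun_zero (e := e) z.1]
    exact (strictMono_heightFun he z.1).injective.eq_iff.symm
  · intro z
    simpa [hx z] using abs_le_heightFun he z.1 (x z)
  · intro z z' h1 h2
    simp only [h1] at h2
    have h3 := (strictMono_angleFun he (x z')).injective h2
    refine Prod.ext h3 ?_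
    rw [← hx z, ← hx z', h1, h3]

/-! ### Complex projective space in the affine chart of index `0` -/

namespace CP

variable {n : ℕ}

lemma chartIndex_affineInv_zero (w : Fin n → ℂ) : chartIndex (affineInv 0 w) = 0 := by
  classical
  refine le_antisymm ?_ (Fin.zero_le _)
  exact Fin.find_le_of_pos _ (affineInv_mem 0 w)

lemma chartAt_affineInv_zero (w : Fin n → ℂ) :
    chartAt (Fin n → ℂ) (affineInv 0 w) = affineChart 0 :=
  congrArg affineChart (chartIndex_affineInv_zero w)

lemma fubiniStudy_affineInv_zero (w : Fin n → ℂ) :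
    fubiniStudy (affineInv 0 w) = fubiniStudyAffine w := by
  unfold fubiniStudy
  rw [chartAt_affineInv_zero]
  exact congrArg fubiniStudyAffine (affineCoord_affineInv 0 w)

lemma isOpenEmbedding_affineInv (j : Fin (n + 1)) : IsOpenEmbedding (affineInv j : _ → CP n) :=
  (affineChart j).symm.isOpenEmbedding rfl

lemma contMDiff_affineInv (j : Fin (n + 1)) :
    ContMDiff 𝓘(ℝ, Fin n → ℂ) 𝓘(ℝ, Fin n → ℂ) ∞ (affineInv j : _ → CP n) := by
  have h : affineChart j ∈ IsManifold.maximalAtlas 𝓘(ℝ, Fin n → ℂ) ∞ (CP n) :=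
    IsManifold.subset_maximalAtlas ⟨j, rfl⟩
  exact contMDiffOn_univ.1 (contMDiffOn_symm_of_mem_maximalAtlas h)

/-- The preferred chart takes the smallest nonzero index, so on the image of `affineInv 0` it is
always chart `0`, and the coordinate expression of the composite is `f` itself. -/
lemma mfderiv_affineInv_zero_comp {E : Type*} [NormedAddCommGroup E] [NormedSpace ℝ E]
    {f : E → Fin n → ℂ} {x : E} (hf : DifferentiableAt ℝ f x) :
    (mfderiv 𝓘(ℝ, E) 𝓘(ℝ, Fin n → ℂ) (fun y => affineInv 0 (f y)) x : E →L[ℝ] (Fin n → ℂ))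
      = fderiv ℝ f x := by
  have hm : MDifferentiableAt 𝓘(ℝ, E) 𝓘(ℝ, Fin n → ℂ) (fun y => affineInv 0 (f y)) x :=
    ((contMDiff_affineInv 0).mdifferentiable (by simp) (f x)).comp x hf.mdifferentiableAt
  rw [hm.mfderiv]
  simp only [writtenInExtChartAt, extChartAt, mfld_simps, fderivWithin_univ]
  rw [chartAt_affineInv_zero]
  congr 1
  funext y
  exact affineCoord_affineInv 0 (f y)

lemma affineInv_mem_cliffordTorus (j : Fin (n + 1)) (w : Fin n → ℂ) :
    affineInv j w ∈ cliffordTorus n ↔ ∀ k, ‖w k‖ = 1 := by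
  constructor
  · rintro ⟨v, hv, hvn, h⟩ k
    have hvj : v j ≠ 0 := by
      rw [← mk_mem_affineSource j v hv, h]
      exact affineInv_mem j w
    have h2 := congrFun (congrArg (affineCoord j) h) k
    rw [affineCoord_mk, affineCoord_affineInv] at h2
    rw [← h2, norm_div, hvn _ j, div_self (norm_ne_zero_iff.2 hvj)]
  · intro h
    have h1 : ∀ i, ‖(j.insertNth 1 w : Fin (n + 1) → ℂ) i‖ = 1 := fun i => by
      refine Fin.succAboveCases j ?_ (fun l => ?_) i
      · simp
      · simpa using h l
    exact ⟨_, insertNth_one_ne_zero j w, fun i i' => by rw [h1, h1], rfl⟩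

/-! ### Moment–angle coordinates for the Fubini–Study form -/

/-- The Fubini–Study form in logarithmic affine coordinates. -/
lemma fubiniStudyAffine_mul {w ζ ζ' : Fin n → ℂ} {μ : Fin n → ℝ} {μ₀ : ℝ} (hμ₀ : 0 < μ₀)
    (hsum : μ₀ + ∑ k, μ k = 1) (hw : ∀ k, ‖w k‖ ^ 2 = μ k / μ₀) :
    fubiniStudyAffine w (w * ζ) (w * ζ') =
      ∑ k, μ k * ((ζ k).re * (ζ' k).im - (ζ k).im * (ζ' k).re)
        - ((∑ k, μ k * (ζ k).re) * (∑ k, μ k * (ζ' k).im)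
          - (∑ k, μ k * (ζ k).im) * (∑ k, μ k * (ζ' k).re)) := by
  have hμ₀' : (μ₀ : ℂ) ≠ 0 := by exact_mod_cast hμ₀.ne'
  have hsum' : (μ₀ : ℂ) + ∑ k, (μ k : ℂ) = 1 := by exact_mod_cast hsum
  have hw' : ∀ k, star (w k) * w k = (μ k : ℂ) / μ₀ := fun k => by
    have := Complex.conj_mul' (w k)
    rw [← Complex.ofReal_pow, hw k] at this
    simpa using this
  have h1 : herm w w = (∑ k, (μ k : ℂ)) / μ₀ := by
    simp only [herm, dotProduct, Pi.star_apply, hw', Finset.sum_div]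
  have h2 : herm (w * ζ) (w * ζ') = (∑ k, μ k * (star (ζ k) * ζ' k)) / μ₀ := by
    simp only [herm, dotProduct, Pi.star_apply, Pi.mul_apply, star_mul, Finset.sum_div]
    refine Finset.sum_congr rfl fun k _ => ?_
    linear_combination star (ζ k) * ζ' k * hw' k
  have h3 : herm (w * ζ) w = (∑ k, μ k * star (ζ k)) / μ₀ := by
    simp only [herm, dotProduct, Pi.star_apply, Pi.mul_apply, star_mul, Finset.sum_div]
    refine Finset.sum_congr rfl fun k _ => ?_
    linear_combination star (ζ k) * hw' k
  have h4 : herm w (w * ζ') = (∑ k, μ k * ζ' k) / μ₀ := by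
    simp only [herm, dotProduct, Pi.star_apply, Pi.mul_apply, Finset.sum_div]
    refine Finset.sum_congr rfl fun k _ => ?_
    linear_combination ζ' k * hw' k
  have h5 : 1 + herm w w = 1 / μ₀ := by
    rw [h1]
    field_simp
    exact hsum'
  have h6 : ((1 + herm w w) * herm (w * ζ) (w * ζ') - herm (w * ζ) w * herm w (w * ζ'))
      / (1 + herm w w) ^ 2 = ∑ k, μ k * (star (ζ k) * ζ' k)
        - (∑ k, μ k * star (ζ k)) * ∑ k, μ k * ζ' k := by
    rw [h5, h2, h3, h4]
    field_simp
  have h7 : fubiniStudyAffine w (w * ζ) (w * ζ') = _ := congrArg Complex.im h6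
  rw [h7]
  simp only [Complex.sub_im, Complex.mul_im, Complex.im_sum, Complex.re_sum, Complex.ofReal_re,
    Complex.ofReal_im, Complex.mul_re, Complex.star_def, Complex.conj_re, Complex.conj_im,
    zero_mul, sub_zero, add_zero]
  simp only [mul_neg, neg_mul, Finset.sum_neg_distrib, sub_eq_add_neg, neg_add, neg_neg]

/-- The affine coordinates of the point with barycentric moment coordinates `μ₀, μ` and angles
`t`. -/
noncomputable def toricCoord (μ₀ : ℝ) (μ t : Fin n → ℝ) (k : Fin n) : ℂ :=
  Complex.exp (((Real.log (μ k) - Real.log μ₀) / 2 : ℝ) + t k * Complex.I)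

lemma norm_toricCoord_sq {μ₀ : ℝ} {μ : Fin n → ℝ} (t : Fin n → ℝ) (hμ₀ : 0 < μ₀)
    {k : Fin n} (hμ : 0 < μ k) : ‖toricCoord μ₀ μ t k‖ ^ 2 = μ k / μ₀ := by
  rw [toricCoord, Complex.norm_exp, ← Real.exp_nat_mul, ← Real.log_div hμ.ne' hμ₀.ne']
  simp only [Complex.add_re, Complex.ofReal_re, Complex.mul_re, Complex.I_re, Complex.I_im,
    Complex.ofReal_im]
  norm_num
  rw [mul_div_cancel₀ _ two_ne_zero, Real.exp_log (by positivity)]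

/-- Moduli give the ratios `μₖ / μ₀`, and the normalisation recovers `μ₀` from their sum; the angles
follow because `exp` is injective on the strip of imaginary parts in `(-π, π]`. -/
lemma toricCoord_injective {μ₀ ν₀ : ℝ} {μ ν t s : Fin n → ℝ} (hμ₀ : 0 < μ₀) (hν₀ : 0 < ν₀)
    (hμ : ∀ k, 0 < μ k) (hν : ∀ k, 0 < ν k) (hμs : μ₀ + ∑ k, μ k = 1) (hνs : ν₀ + ∑ k, ν k = 1)
    (ht : ∀ k, |t k| < Real.pi) (hs : ∀ k, |s k| < Real.pi)
    (h : toricCoord μ₀ μ t = toricCoord ν₀ ν s) : μ = ν ∧ t = s := by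
  have h1 : ∀ k, μ k / μ₀ = ν k / ν₀ := fun k => by
    rw [← norm_toricCoord_sq t hμ₀ (hμ k), ← norm_toricCoord_sq s hν₀ (hν k), h]
  have h2 : ∑ k, μ k / μ₀ = ∑ k, ν k / ν₀ := Finset.sum_congr rfl fun k _ => h1 k
  rw [← Finset.sum_div, ← Finset.sum_div, div_eq_div_iff hμ₀.ne' hν₀.ne'] at h2
  have h3 : μ₀ = ν₀ := by linear_combination -h2 + ν₀ * hμs - μ₀ * hνs
  refine ⟨funext fun k => ?_, funext fun k => ?_⟩
  · have := h1 k
    rw [h3] at this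
    exact (div_left_inj' hν₀.ne').1 this
  · have h4 := congrArg Complex.im (Complex.exp_inj_of_neg_pi_lt_of_le_pi ?_ ?_ ?_ ?_ (congrFun h k))
    · simpa using h4
    · simpa using (abs_lt.1 (ht k)).1
    · simpa using (abs_lt.1 (ht k)).2.le
    · simpa using (abs_lt.1 (hs k)).1
    · simpa using (abs_lt.1 (hs k)).2.le

/-- In toric coordinates the Fubini–Study form is `½ ∑ dμₖ ∧ dtₖ`. -/
lemma fubiniStudyAffine_toricCoord {E : Type*} [NormedAddCommGroup E] [NormedSpace ℝ E]
    {μ₀ : E → ℝ} {μ t : E → Fin n → ℝ} {x : E}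
    (hμ₀ : 0 < μ₀ x) (hμ : ∀ k, 0 < μ x k) (hsum : ∀ y, μ₀ y + ∑ k, μ y k = 1)
    (dμ : ∀ k, DifferentiableAt ℝ (fun y => μ y k) x)
    (dt : ∀ k, DifferentiableAt ℝ (fun y => t y k) x) (u v : E) :
    fubiniStudyAffine (toricCoord (μ₀ x) (μ x) (t x))
      (fderiv ℝ (fun y => toricCoord (μ₀ y) (μ y) (t y)) x u)
      (fderiv ℝ (fun y => toricCoord (μ₀ y) (μ y) (t y)) x v) =
      (∑ k, (fderiv ℝ (fun y => μ y k) x u * fderiv ℝ (fun y => t y k) x v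
        - fderiv ℝ (fun y => μ y k) x v * fderiv ℝ (fun y => t y k) x u)) / 2 := by
  have hm₀ : HasFDerivAt μ₀ (-∑ k, fderiv ℝ (fun y => μ y k) x) x := by
    have h : μ₀ = fun y => 1 - ∑ k, μ y k := funext fun y => eq_sub_of_add_eq (hsum y)
    rw [h]
    exact (HasFDerivAt.fun_sum fun k _ => (dμ k).hasFDerivAt).const_sub 1
  have hder : ∀ u, fderiv ℝ (fun y => toricCoord (μ₀ y) (μ y) (t y)) x u
      = toricCoord (μ₀ x) (μ x) (t x) * fun k => (⟨(fderiv ℝ (fun y => μ y k) x u / μ x k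
        + (∑ l, fderiv ℝ (fun y => μ y l) x u) / μ₀ x) / 2, fderiv ℝ (fun y => t y k) x u⟩ : ℂ) := by
    intro u
    have h : ∀ k, HasFDerivAt (fun y => toricCoord (μ₀ y) (μ y) (t y) k) _ x := fun k =>
      (((Complex.ofRealCLM.hasFDerivAt.comp x ((((dμ k).hasFDerivAt.log (hμ k).ne').sub
        (hm₀.log hμ₀.ne')).mul_const (2⁻¹ : ℝ))).add
          ((Complex.ofRealCLM.hasFDerivAt.comp x (dt k).hasFDerivAt).mul_const Complex.I))).cexp
    rw [(hasFDerivAt_pi.2 h).fderiv]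
    funext k
    have h1 := (hμ k).ne'
    have h2 := hμ₀.ne'
    simp [toricCoord, Complex.ext_iff]
    rw [← div_eq_mul_inv]
    constructor <;> field_simp <;> ring
  rw [hder u, hder v, fubiniStudyAffine_mul hμ₀ (hsum x) fun k => norm_toricCoord_sq _ hμ₀ (hμ k)]
  have hS : ∑ k, μ x k = 1 - μ₀ x := eq_sub_of_add_eq' (hsum x)
  -- By `∑ μₖ = 1 - μ₀`, this weighted sum is exactly the term common to all the logarithmic
  -- derivatives, so the rank-one correction in the form cancels that term.
  have hα : ∀ u, ∑ k, μ x k * ((fderiv ℝ (fun y => μ y k) x u / μ x k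
        + (∑ l, fderiv ℝ (fun y => μ y l) x u) / μ₀ x) / 2)
      = (∑ l, fderiv ℝ (fun y => μ y l) x u) / μ₀ x / 2 := fun u => by
    have : ∀ k, μ x k * ((fderiv ℝ (fun y => μ y k) x u / μ x k
        + (∑ l, fderiv ℝ (fun y => μ y l) x u) / μ₀ x) / 2) = fderiv ℝ (fun y => μ y k) x u / 2
          + μ x k * ((∑ l, fderiv ℝ (fun y => μ y l) x u) / μ₀ x / 2) := fun k => by
      have := (hμ k).ne'
      field_simp
    rw [Finset.sum_congr rfl fun k _ => this k, Finset.sum_add_distrib, ← Finset.sum_mul,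
      ← Finset.sum_div, hS]
    field_simp
    ring
  simp only [hα]
  generalize (∑ l, fderiv ℝ (fun y => μ y l) x u) / μ₀ x = a
  generalize (∑ l, fderiv ℝ (fun y => μ y l) x v) / μ₀ x = b
  rw [Finset.mul_sum, Finset.sum_mul, ← Finset.sum_sub_distrib, ← Finset.sum_sub_distrib,
    Finset.sum_div]
  refine Finset.sum_congr rfl fun k _ => ?_
  have := (hμ k).ne'
  field_simp
  ring

end CP

/-! ### The packing -/

/-- The projection of `ℝ²ⁿ` to the `k`-th symplectic coordinate plane. -/
noncomputable def planeProj {n : ℕ} (k : Fin n) : PhaseSpace n →L[ℝ] ℝ × ℝ :=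
  (EuclideanSpace.proj (Sum.inl k)).prod (EuclideanSpace.proj (Sum.inr k))

@[simp]
lemma planeProj_apply {n : ℕ} (k : Fin n) (x : PhaseSpace n) :
    planeProj k x = (x (Sum.inl k), x (Sum.inr k)) := rfl

lemma eq_zero_of_omegaStd_eq_zero {n : ℕ} {u : PhaseSpace n} (h : ∀ v, omegaStd u v = 0) :
    u = 0 := by
  ext (k | k)
  · simpa [omegaStd] using h (EuclideanSpace.single (Sum.inr k) 1)
  · simpa [omegaStd] using h (EuclideanSpace.single (Sum.inl k) 1)

/-- In equal dimensions an injective derivative is invertible, so the map is open by the inverse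
function theorem; an injective continuous open map is an embedding. -/
lemma isEmbedding_restrict_of_injective_fderiv {E F : Type*} [NormedAddCommGroup E]
    [NormedSpace ℝ E] [NormedAddCommGroup F] [NormedSpace ℝ F] [FiniteDimensional ℝ E]
    [FiniteDimensional ℝ F] (hdim : Module.finrank ℝ E = Module.finrank ℝ F) {f : E → F}
    {s : Set E} (hs : IsOpen s) (hf : ContDiffOn ℝ ∞ f s) (hinj : InjOn f s)
    (hder : ∀ x ∈ s, Function.Injective (fderiv ℝ f x)) :
    IsEmbedding fun x : s => f x := by
  refine (IsOpenEmbedding.of_continuous_injective_isOpenMap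
    (continuousOn_iff_continuous_domRestrict.1 hf.continuousOn) hinj.injective ?_).isEmbedding
  refine IsOpenMap.of_nhds_le fun x => ?_
  obtain ⟨f', hf'⟩ := exists_hasStrictFDerivAt_equiv hdim (hf.contDiffAt (hs.mem_nhds x.2))
    (hder x x.2)
  change 𝓝 (f x) ≤ Filter.map (f ∘ Subtype.val) (𝓝 x)
  rw [← Filter.map_map, map_nhds_subtype_coe_eq_nhds x.2 (hs.mem_nhds x.2),
    hf'.map_nhds_eq_of_equiv]

theorem theorem1 (r : ℝ) (hr : 0 < r) (hr' : r < Real.sqrt (2 / 3)) :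
    ∃ i : PhaseSpace 2 → CP 2, IsRelativePacking CP.fubiniStudy (CP.cliffordTorus 2) r i := by
  have hr2 : r ^ 2 < 2 / 3 := (Real.lt_sqrt hr.le).1 hr'
  obtain ⟨X, T, hX, hT, hXT, hTπ, hX0, hXle, hinj⟩ :=
    -- As `|pₖ| < 1` on the ball, `2(|X₀| + |X₁|) < r² + 4e + 2e²`. With `r² = 2/3 - 6e` the right
    -- side is `2/3 - 2e(1 - e) < 2/3`.
    exists_planar_map (e := (2 / 3 - r ^ 2) / 6) (by linarith)
  let μ : PhaseSpace 2 → Fin 2 → ℝ := fun x k => 1 / 3 + X (planeProj k x)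
  let μ₀ : PhaseSpace 2 → ℝ := fun x => 1 - ∑ k, μ x k
  let t : PhaseSpace 2 → Fin 2 → ℝ := fun x k => T (planeProj k x)
  let f : PhaseSpace 2 → Fin 2 → ℂ := fun x => CP.toricCoord (μ₀ x) (μ x) (t x)
  have hsum : ∀ x, μ₀ x + ∑ k, μ x k = 1 := fun x => sub_add_cancel _ _
  have hbound : ∀ x ∈ stdBall 2 r, |X (planeProj 0 x)| + |X (planeProj 1 x)| < 1 / 3 := by
    intro x hx
    have hx1 : ‖x‖ < r := by simpa [stdBall] using hx
    have hx2 : x (Sum.inl 0) ^ 2 + x (Sum.inl 1) ^ 2 + (x (Sum.inr 0) ^ 2 + x (Sum.inr 1) ^ 2)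
        < r ^ 2 := by
      have h := pow_lt_pow_left₀ hx1 (norm_nonneg x) two_ne_zero
      rw [EuclideanSpace.real_norm_sq_eq] at h
      simpa [Fintype.sum_sum_type, Fin.sum_univ_two] using h
    have h0 := hXle (planeProj 0 x)
    have h1 := hXle (planeProj 1 x)
    simp only [planeProj_apply] at h0 h1 ⊢
    have hp : ∀ p : ℝ, p ^ 2 < 2 / 3 → |p| < 1 := fun p hp => by
      rw [← sq_lt_one_iff_abs_lt_one]; linarith
    have hp0 := hp (x (Sum.inr 0)) (by nlinarith)
    have hp1 := hp (x (Sum.inr 1)) (by nlinarith)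
    have ha0 := sq_abs (x (Sum.inr 0))
    have ha1 := sq_abs (x (Sum.inr 1))
    have hr0 := sq_nonneg r
    nlinarith
  have hμ : ∀ x ∈ stdBall 2 r, ∀ k, 0 < μ x k := fun x hx => by
    have h := hbound x hx
    have h0 := abs_nonneg (X (planeProj 0 x))
    have h1 := abs_nonneg (X (planeProj 1 x))
    refine Fin.forall_fin_two.2 ⟨?_, ?_⟩
    · simp only [μ]
      linarith [neg_abs_le (X (planeProj 0 x))]
    · simp only [μ]
      linarith [neg_abs_le (X (planeProj 1 x))]
  have hμ₀ : ∀ x ∈ stdBall 2 r, 0 < μ₀ x := fun x hx => by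
    simp only [μ₀, μ, Fin.sum_univ_two]
    linarith [hbound x hx, le_abs_self (X (planeProj 0 x)), le_abs_self (X (planeProj 1 x))]
  have hμs : ∀ k, ContDiff ℝ ∞ fun x => μ x k := fun k =>
    contDiff_const.add (hX.comp (planeProj k).contDiff)
  have hμ₀s : ContDiff ℝ ∞ μ₀ := contDiff_const.sub (ContDiff.sum fun k _ => hμs k)
  have hts : ∀ k, ContDiff ℝ ∞ fun x => t x k := fun k => hT.comp (planeProj k).contDiff
  have hopen : IsOpen (stdBall 2 r) := Metric.isOpen_ball
  have hfs : ContDiffOn ℝ ∞ f (stdBall 2 r) := by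
    refine contDiffOn_pi.2 fun k => ?_
    have h1 : ContDiffOn ℝ ∞ (fun x => (Real.log (μ x k) - Real.log (μ₀ x)) / 2) (stdBall 2 r) :=
      (((hμs k).contDiffOn.log fun x hx => (hμ x hx k).ne').sub
        (hμ₀s.contDiffOn.log fun x hx => (hμ₀ x hx).ne')).div_const 2
    exact ((Complex.ofRealCLM.contDiff.comp_contDiffOn h1).add
      (((Complex.ofRealCLM.contDiff.comp (hts k)).mul contDiff_const).contDiffOn)).cexp
  have hfd : ∀ x ∈ stdBall 2 r, DifferentiableAt ℝ f x := fun x hx =>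
    (hfs.contDiffAt (hopen.mem_nhds hx)).differentiableAt (by simp)
  have hfinj : InjOn f (stdBall 2 r) := by
    intro x hx y hy h
    obtain ⟨h1, h2⟩ := CP.toricCoord_injective (hμ₀ x hx) (hμ₀ y hy) (hμ x hx) (hμ y hy)
      (hsum x) (hsum y) (fun k => hTπ _) (fun k => hTπ _) h
    have h3 : ∀ k, planeProj k x = planeProj k y := fun k =>
      hinj _ _ (add_left_cancel (congrFun h1 k)) (congrFun h2 k)
    ext (k | k)
    · exact congrArg Prod.fst (h3 k)
    · exact congrArg Prod.snd (h3 k)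
  have hsymp : ∀ x ∈ stdBall 2 r, ∀ u v, CP.fubiniStudyAffine (f x) (fderiv ℝ f x u)
      (fderiv ℝ f x v) = omegaStd u v := by
    intro x hx u v
    rw [CP.fubiniStudyAffine_toricCoord (hμ₀ x hx) (hμ x hx) hsum
      (fun k => (hμs k).differentiable (by simp) x) (fun k => (hts k).differentiable (by simp) x)]
    have hμd : ∀ k w, fderiv ℝ (fun x => μ x k) x w = fderiv ℝ X (planeProj k x) (planeProj k w) := by
      intro k w
      have h := (hX.differentiable (by simp) (planeProj k x)).hasFDerivAt.comp x
        (planeProj k).hasFDerivAt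
      exact DFunLike.congr_fun (h.const_add (1 / 3)).fderiv w
    have htd : ∀ k w, fderiv ℝ (fun x => t x k) x w = fderiv ℝ T (planeProj k x) (planeProj k w) := by
      intro k w
      have h := (hT.differentiable (by simp) (planeProj k x)).hasFDerivAt.comp x
        (planeProj k).hasFDerivAt
      exact DFunLike.congr_fun h.fderiv w
    simp only [hμd, htd, hXT]
    rw [← Finset.mul_sum, mul_div_cancel_left₀ _ two_ne_zero]
    rfl
  have hfdinj : ∀ x ∈ stdBall 2 r, Function.Injective (fderiv ℝ f x) := by
    refine fun x hx => (injective_iff_map_eq_zero _).2 fun u hu => ?_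
    -- The immersion property comes for free: a kernel vector of the derivative would lie in the
    -- kernel of `omegaStd`, which is nondegenerate.
    refine eq_zero_of_omegaStd_eq_zero fun v => ?_
    rw [← hsymp x hx, hu, map_zero, LinearMap.zero_apply]
  have hdim : Module.finrank ℝ (PhaseSpace 2) = Module.finrank ℝ (Fin 2 → ℂ) := by
    simp [Module.finrank_pi_fintype]
  refine ⟨fun x => CP.affineInv 0 (f x), ⟨?_, ?_, ?_, ?_⟩, ?_⟩
  · exact (CP.contMDiff_affineInv 0).comp_contMDiffOn (contMDiffOn_iff_contDiffOn.2 hfs)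
  · intro x hx
    rw [CP.mfderiv_affineInv_zero_comp (hfd x hx)]
    exact hfdinj x hx
  · exact (CP.isOpenEmbedding_affineInv 0).isEmbedding.comp
      (isEmbedding_restrict_of_injective_fderiv hdim hopen hfs hfinj hfdinj)
  · intro x hx u v
    rw [CP.mfderiv_affineInv_zero_comp (hfd x hx), CP.fubiniStudy_affineInv_zero]
    exact hsymp x hx u v
  · ext x
    refine and_congr_right fun hx => ?_
    have h1 : ∀ k, ‖f x k‖ = 1 ↔ μ x k = μ₀ x := fun k => by
      rw [← div_eq_one_iff_eq (hμ₀ x hx).ne', ← CP.norm_toricCoord_sq (t x) (hμ₀ x hx) (hμ x hx k)]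
      exact (pow_eq_one_iff_of_nonneg (norm_nonneg _) two_ne_zero).symm
    have h2 : ∀ k : Fin 2, x (Sum.inr k) = 0 ↔ X (planeProj k x) = 0 := fun k =>
      (hX0 (planeProj k x)).symm
    simp only [mem_preimage, CP.affineInv_mem_cliffordTorus, h1, h2, Fin.forall_fin_two, μ₀, μ,
      Fin.sum_univ_two]
    -- The equations `Xₖ = -X₀ - X₁` for `k = 0, 1` have only the zero solution.
    constructor
    · rintro ⟨h, h'⟩
      constructor <;> linarith
    · rintro ⟨h, h'⟩
      rw [h, h']
      norm_num
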